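/- Let $n$ be a non-negative integer and let $A, B$ be complex $n \times n$ matrices such that $$e^{kA+B} = e^{kA}e^{B} = e^{B}e^{kA} \quad \text{for every integer } k \ge 0.$$ Then the pair $(A,B)$ has property L of Motzkin and Taussky: there are orderings $(\lambda_i)_{1\le i\le n}$ and $(\mu_i)_{1\le i\le n}$ of the eigenvalues of $A$ and of $B$, counted with algebraic multiplicity, such that for all complex numbers $x, y$ the eigenvalues of $xA+yB$, counted with algebraic multiplicity, are $(x\lambda_i+y\mu_i)_{1\le i\le n}$; that is, $\det(tI_n-xA-yB)=\prod_{i=1}^{n}(t-x\lambda_i-y\mu_i)$ for all $t,x,y\in\mathbb{C}$. -/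

import Mathlib

/-- A pair `(A, B)` of complex `n × n` matrices has property L (Motzkin–Taussky): there are
orderings `lam` and `mu` of the eigenvalues of `A` and of `B`, counted with algebraic
multiplicity, such that for all complex numbers `x`, `y` the eigenvalues of `x A + y B`, counted
with algebraic multiplicity, are the numbers `x * lam i + y * mu i`. A list of `n` numbers is the
list of eigenvalues of a matrix when its characteristic polynomial is the product of the
corresponding linear factors. -/
def HasPropertyL {n : ℕ} (A B : Matrix (Fin n) (Fin n) ℂ) : Prop :=
  ∃ lam mu : Fin n → ℂ,
    A.charpoly = ∏ i, (Polynomial.X - Polynomial.C (lam i)) ∧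
    B.charpoly = ∏ i, (Polynomial.X - Polynomial.C (mu i)) ∧
    ∀ x y : ℂ, (x • A + y • B).charpoly =
      ∏ i, (Polynomial.X - Polynomial.C (x * lam i + y * mu i))

/-! Let P(z,t) = det(t - zA - B). At a natural number z = k, commutation of the two exponentials
forces each root t to be kλ + μ modulo 2πi, with λ, μ eigenvalues of A and B
(`Matrix.exists_eigenvalues_of_exp_smul_add`). It remains to show that P splits into factors t - (az
+ b).

A separable factor Q of P has a holomorphic root f on a right half plane, with |f(z)| = O(1 + |z|).
Cauchy's estimate makes f'' decay, so second divided differences of f at k+p, k+q, k+r tend to 0.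
When the three points share the same pair (λ, μ), the difference lies in 2πiℤ, so it is eventually
0. By pigeonhole one triple (p,q,r) serves infinitely many k, and since f is algebraic the relation
holds identically. As a recurrence it continues f to the left; the growth bound persists, and
Liouville's argument gives f'' = 0. Thus f is affine, a linear factor splits off, and induction on
the degree finishes. -/

/-! ### Separable factors over ℂ[z] -/

open Polynomial in
-- Q is the minimal polynomial of a root of P in an algebraic closure of ℂ(z). As ℂ[z] is integrally
-- closed, Q stays minimal over ℂ(z), hence is separable in characteristic zero, and r is its
-- resultant with its derivative.
theorem Polynomial.Monic.exists_dvd_resultant_derivative_ne_zero {P : ℂ[X][X]} (hP : P.Monic)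
    (hd : P.natDegree ≠ 0) :
    ∃ Q : ℂ[X][X], Q.Monic ∧ Q ∣ P ∧ Q.natDegree ≠ 0 ∧
      ∃ (r : ℂ[X]) (p q : ℂ[X][X]), r ≠ 0 ∧ Q * p + derivative Q * q = C r := by
  let K := FractionRing ℂ[X]
  let L := AlgebraicClosure K
  have : Module.IsTorsionFree ℂ[X] L :=
    Module.isTorsionFree_iff_faithfulSMul.mpr <| (faithfulSMul_iff_algebraMap_injective _ _).mpr <| by
      rw [IsScalarTower.algebraMap_eq ℂ[X] K L]
      exact (algebraMap K L).injective.comp (IsFractionRing.injective _ _)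
  have hdeg : (P.map (algebraMap ℂ[X] L)).degree ≠ 0 := by
    rw [hP.degree_map, degree_eq_natDegree hP.ne_zero]
    exact_mod_cast hd
  obtain ⟨θ, hθ⟩ := IsAlgClosed.exists_root _ hdeg
  have hθ' : aeval θ P = 0 := by
    simpa [IsRoot.def, eval_map_algebraMap] using hθ
  have hint : IsIntegral ℂ[X] θ := ⟨P, hP, by simpa [aeval_def] using hθ'⟩
  have hQ : (minpoly ℂ[X] θ).Monic := minpoly.monic hint
  have hpos : 0 < (minpoly ℂ[X] θ).natDegree := minpoly.natDegree_pos hint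
  refine ⟨minpoly ℂ[X] θ, hQ, minpoly.isIntegrallyClosed_dvd hint hθ', hpos.ne', ?_⟩
  obtain ⟨p, q, -, -, h⟩ := exists_mul_add_mul_eq_C_resultant (minpoly ℂ[X] θ)
    (derivative (minpoly ℂ[X] θ)) le_rfl le_rfl (Or.inl hpos.ne')
  refine ⟨_, p, q, fun h0 => ?_, h⟩
  have hinj : Function.Injective (algebraMap ℂ[X] K) := IsFractionRing.injective _ _
  have hmap := minpoly.isIntegrallyClosed_eq_field_fractions' K hint
  have hintK : IsIntegral K θ := hint.tower_top
  have hsep : (minpoly K θ).Separable := (minpoly.irreducible hintK).separable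
  have hr := resultant_map_map (minpoly ℂ[X] θ) (derivative (minpoly ℂ[X] θ))
    (minpoly ℂ[X] θ).natDegree (derivative (minpoly ℂ[X] θ)).natDegree (algebraMap ℂ[X] K)
  rw [h0, map_zero, ← natDegree_map_eq_of_injective hinj (minpoly ℂ[X] θ),
    ← natDegree_map_eq_of_injective hinj (derivative (minpoly ℂ[X] θ)), ← derivative_map, ← hmap,
    resultant_eq_zero_iff] at hr
  exact hr.2 hsep

/-! ### The zero locus as a covering, and holomorphic roots -/

open Polynomial in
theorem Polynomial.contDiff_evalEval (Q : ℂ[X][X]) (n : WithTop ℕ∞) :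
    ContDiff ℂ n fun u : ℂ × ℂ => Q.evalEval u.1 u.2 := by
  have : (fun u : ℂ × ℂ => Q.evalEval u.1 u.2) =
      fun u => ∑ i ∈ Finset.range (Q.natDegree + 1), (Q.coeff i).eval u.1 * u.2 ^ i := by
    ext u
    rw [← map_evalRingHom_eval, eval_map, eval₂_eq_sum_range]
    rfl
  rw [this]
  refine ContDiff.sum fun i _ => ContDiff.mul ?_ (by fun_prop)
  exact ((Q.coeff i).contDiff_aeval n).comp contDiff_fst

open Polynomial in
theorem Polynomial.hasDerivAt_evalEval_right (Q : ℂ[X][X]) (z t : ℂ) :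
    HasDerivAt (fun t => Q.evalEval z t) ((derivative Q).evalEval z t) t := by
  simp only [← map_evalRingHom_eval, ← derivative_map]
  exact Polynomial.hasDerivAt _ _

open Polynomial Topology in
theorem Polynomial.exists_hasStrictFDerivAt_evalEval (Q : ℂ[X][X]) {u : ℂ × ℂ}
    (hu : (derivative Q).evalEval u.1 u.2 ≠ 0) :
    ∃ f' : ℂ × ℂ →L[ℂ] ℂ, HasStrictFDerivAt (fun u : ℂ × ℂ => Q.evalEval u.1 u.2) f' u ∧
      (f' ∘L .inr ℂ ℂ ℂ).IsInvertible := by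
  have h := (Q.contDiff_evalEval 1).contDiffAt (x := u) |>.hasStrictFDerivAt one_ne_zero
  refine ⟨_, h, ContinuousLinearEquiv.unitsEquivAut ℂ (Units.mk0 _ hu), ?_⟩
  have h2 : HasDerivAt (fun t : ℂ => (u.1, t)) ((0 : ℂ), (1 : ℂ)) u.2 :=
    (hasDerivAt_const _ _).prodMk (hasDerivAt_id _)
  have h3 := HasFDerivAt.comp_hasDerivAt u.2 h.hasFDerivAt h2
  ext
  simpa using (Q.hasDerivAt_evalEval_right u.1 u.2).unique h3

open Polynomial Topology in
-- Where ∂Q/∂t ≠ 0, the map (z,t) ↦ (Q(z,t), z) is a local homeomorphism of ℂ²; the chart is its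
-- restriction to the slice Q = 0.
theorem Polynomial.isLocalHomeomorphOn_fst_zeroLocus (Q : ℂ[X][X]) :
    IsLocalHomeomorphOn (fun u : ({u : ℂ × ℂ | Q.evalEval u.1 u.2 = 0} : Set (ℂ × ℂ)) => u.1.1)
      {u | (derivative Q).evalEval u.1.1 u.1.2 ≠ 0} := by
  classical
  refine IsLocalHomeomorphOn.mk _ _ fun u hu => ?_
  obtain ⟨f', hf, hinv⟩ := Q.exists_hasStrictFDerivAt_evalEval hu
  let φ := hf.implicitFunctionDataOfProdDomain hinv
  let e := φ.toOpenPartialHomeomorph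
  have he (v : ℂ × ℂ) : e v = (Q.evalEval v.1 v.2, v.1) := rfl
  have hsymm {z : ℂ} (hz : (0, z) ∈ e.target) :
      Q.evalEval (e.symm (0, z)).1 (e.symm (0, z)).2 = 0 ∧ (e.symm (0, z)).1 = z := by
    simpa [he] using e.right_inv hz
  refine ⟨
    { toFun := fun u => u.1.1
      invFun := fun z => if hz : (0, z) ∈ e.target then ⟨e.symm (0, z), (hsymm hz).1⟩ else u
      source := Subtype.val ⁻¹' e.source
      target := {z | (0, z) ∈ e.target}
      map_source' := fun v hv => by simpa [he, show Q.evalEval v.1.1 v.1.2 = 0 from v.2] using e.map_source hv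
      map_target' := fun z hz => by
        simp only [Set.mem_ofPred_eq] at hz
        simp [hz, e.map_target hz]
      left_inv' := fun v hv => by
        have h1 : e v = (0, v.1.1) := by simp [he, show Q.evalEval v.1.1 v.1.2 = 0 from v.2]
        have h2 : (0, v.1.1) ∈ e.target := h1 ▸ e.map_source hv
        have h3 : e.symm (0, v.1.1) = v.1 := by rw [← h1, e.left_inv hv]
        simp only [h2, dite_true]
        exact Subtype.ext h3
      right_inv' := fun z hz => by
        simp only [Set.mem_ofPred_eq] at hz
        simpa [hz] using (hsymm hz).2
      open_source := e.open_source.preimage continuous_subtype_val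
      open_target := e.open_target.preimage (by fun_prop : Continuous fun z : ℂ => ((0 : ℂ), z))
      continuousOn_toFun := by fun_prop
      continuousOn_invFun := by
        rw [Topology.IsInducing.subtypeVal.continuousOn_iff]
        refine (e.continuousOn_symm.comp (f := fun z : ℂ => ((0 : ℂ), z)) (by fun_prop)
          fun z hz => hz).congr fun z hz => ?_
        have hz' : (0, z) ∈ e.target := hz
        simp [hz'] },
    φ.pt_mem_toOpenPartialHomeomorph_source, fun _ _ => rfl⟩

open Polynomial Topology in
-- Near (z, f z) the zero locus is the graph of the implicit function, and continuity keeps (w, f w)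
-- in that neighbourhood.
theorem Polynomial.differentiableOn_of_evalEval_eq_zero (Q : ℂ[X][X]) {U : Set ℂ} (hU : IsOpen U)
    {f : ℂ → ℂ} (hf : ContinuousOn f U) (h0 : ∀ z ∈ U, Q.evalEval z (f z) = 0)
    (h1 : ∀ z ∈ U, (derivative Q).evalEval z (f z) ≠ 0) : DifferentiableOn ℂ f U := by
  intro z hz
  obtain ⟨f', hd, hinv⟩ := Q.exists_hasStrictFDerivAt_evalEval (u := (z, f z)) (h1 z hz)
  have hψ := (hd.hasStrictFDerivAt_implicitFunctionOfProdDomain hinv).differentiableAt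
  have hev := hd.eventually_apply_eq_iff_implicitFunctionOfProdDomain hinv
  have hc : ContinuousAt (fun w => (w, f w)) z :=
    continuousAt_id.prodMk (hf.continuousAt (hU.mem_nhds hz))
  refine (hψ.congr_of_eventuallyEq ?_).differentiableWithinAt
  filter_upwards [hc.eventually hev, hU.mem_nhds hz] with w hw hwU
  exact (hw.1 (by simp [h0 w hwU, h0 z hz])).symm

open Polynomial in
theorem Polynomial.Monic.exists_evalEval_eq_zero {Q : ℂ[X][X]} (hQ : Q.Monic)
    (hd : Q.natDegree ≠ 0) (z : ℂ) : ∃ t, Q.evalEval z t = 0 := by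
  have : (Q.map (evalRingHom z)).degree ≠ 0 := by
    rw [hQ.degree_map, degree_eq_natDegree hQ.ne_zero]
    exact_mod_cast hd
  obtain ⟨t, ht⟩ := IsAlgClosed.exists_root _ this
  exact ⟨t, by rwa [IsRoot.def, map_evalRingHom_eval] at ht⟩

open Polynomial Topology in
/-- A monic bivariate polynomial whose resultant with its derivative does not vanish on a simply
connected open set has a holomorphic root there. -/
theorem Polynomial.Monic.exists_differentiableOn_root {Q : ℂ[X][X]} (hQ : Q.Monic)
    (hd : Q.natDegree ≠ 0) {C : ℝ} (hC : ∀ z t, Q.evalEval z t = 0 → ‖t‖ ≤ C * (1 + ‖z‖))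
    {r : ℂ[X]} {p q : ℂ[X][X]} (hr : Q * p + derivative Q * q = Polynomial.C r)
    {U : Set ℂ} (hU : IsOpen U) (hUc : IsSimplyConnected U) (hrU : ∀ z ∈ U, r.eval z ≠ 0) :
    ∃ f : ℂ → ℂ, DifferentiableOn ℂ f U ∧ ∀ z ∈ U, Q.evalEval z (f z) = 0 := by
  classical
  have hder {z t : ℂ} (hz : z ∈ U) (h : Q.evalEval z t = 0) :
      (derivative Q).evalEval z t ≠ 0 := fun h' => hrU z hz <| by
    simpa [h, h', evalEval_mul, evalEval_add, evalEval_C] using (congrArg (evalEval z t) hr).symm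
  let E := ({u : ℂ × ℂ | Q.evalEval u.1 u.2 = 0} : Set (ℂ × ℂ))
  let π : E → ℂ := fun u => u.1.1
  have hπ : Continuous π := by fun_prop
  have hQc := (Q.contDiff_evalEval 0).continuous
  have hclosedE : IsClosed {u : ℂ × ℂ | Q.evalEval u.1 u.2 = 0} :=
    isClosed_eq hQc continuous_const
  -- The growth bound confines the part of the locus above a compact set to a product of compact
  -- sets.
  have hproper : IsProperMap π := by
    rw [isProperMap_iff_isCompact_preimage]
    refine ⟨hπ, fun K hK => ?_⟩
    rw [Topology.IsInducing.subtypeVal.isCompact_iff]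
    obtain ⟨M, hM⟩ := hK.isBounded.exists_norm_le
    refine (hK.prod (isCompact_closedBall (0 : ℂ) (|C| * (1 + M)))).of_isClosed_subset ?_ ?_
    · refine hclosedE.isClosedEmbedding_subtypeVal.isClosedMap _ (hK.isClosed.preimage hπ)
    · rintro _ ⟨u, hu, rfl⟩
      refine ⟨hu, mem_closedBall_zero_iff.2 <| (hC _ _ u.2).trans ?_⟩
      have := hM _ hu
      gcongr
      exact le_abs_self C
  have hfin : ∀ z ∈ U, (π ⁻¹' {z}).Finite := fun z _ => by
    have hne : Q.map (evalRingHom z) ≠ 0 := (hQ.map _).ne_zero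
    refine Set.Finite.of_finite_image (f := fun u : E => u.1.2)
      ((Q.map (evalRingHom z)).roots.toFinset.finite_toSet.subset ?_) ?_
    · rintro _ ⟨u, rfl, rfl⟩
      have hu : u.1.2 ∈ (Q.map (evalRingHom (π u))).roots := by
        rw [mem_roots hne, IsRoot.def, map_evalRingHom_eval]
        exact u.2
      simpa only [Finset.mem_coe, Multiset.mem_toFinset] using hu
    · intro u hu v hv h
      exact Subtype.ext (Prod.ext (hu.trans hv.symm) h)
  have hloc : IsLocalHomeomorphOn π (π ⁻¹' U) :=
    Q.isLocalHomeomorphOn_fst_zeroLocus.mono fun u hu => hder hu u.2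
  -- A closed local homeomorphism with finite fibres is a covering, so the inclusion of the simply
  -- connected U lifts to the zero locus.
  have hcov := hproper.isClosedMap.isCoveringMapOn_of_isLocalHomeomorphOn hfin hloc
  have := hUc.simplyConnectedSpace
  have := hU.locallyPathConnectedSpace
  obtain ⟨z₀, hz₀⟩ := hUc.nonempty
  obtain ⟨t₀, ht₀⟩ := hQ.exists_evalEval_eq_zero hd z₀
  obtain ⟨F, ⟨-, hF⟩, -⟩ := hcov.existsUnique_continuousMap_lifts
    (⟨Subtype.val, continuous_subtype_val⟩ : C(U, ℂ)) (a₀ := ⟨z₀, hz₀⟩) (e₀ := ⟨(z₀, t₀), ht₀⟩)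
    rfl (fun a => a.2)
  let f : ℂ → ℂ := fun z => if hz : z ∈ U then (F ⟨z, hz⟩).1.2 else 0
  have hf0 : ∀ z ∈ U, Q.evalEval z (f z) = 0 := fun z hz => by
    have h1 : (F ⟨z, hz⟩).1.1 = z := congrFun hF ⟨z, hz⟩
    have h2 : Q.evalEval (F ⟨z, hz⟩).1.1 (F ⟨z, hz⟩).1.2 = 0 := (F ⟨z, hz⟩).2
    rw [h1] at h2
    simpa [f, hz] using h2
  have hfc : ContinuousOn f U := by
    rw [continuousOn_iff_continuous_domRestrict]
    have : Continuous fun z : U => (F z).1.2 := by fun_prop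
    convert this using 1
    ext z
    simp [f]
  exact ⟨f, Q.differentiableOn_of_evalEval_eq_zero hU hfc hf0 fun z hz => hder hz (hf0 z hz), hf0⟩

/-! ### Linear growth and second differences -/

open Metric in
-- Cauchy's estimate on the circle of radius ρ. It serves twice: with ρ comparable to |z|, giving
-- decay of f'', and with ρ → ∞, giving f'' = 0.
theorem norm_deriv_deriv_le_of_linear_growth {C ρ : ℝ} {f : ℂ → ℂ} {z : ℂ} (hC0 : 0 ≤ C)
    (hρ : 0 < ρ) (hf : DifferentiableOn ℂ f (closedBall z ρ))
    (hC : ∀ w ∈ closedBall z ρ, ‖f w‖ ≤ C * (1 + ‖w‖)) :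
    ‖deriv (deriv f) z‖ ≤ 2 * (C * (1 + (‖z‖ + ρ))) / ρ ^ 2 := by
  have h := Complex.norm_iteratedDeriv_le_of_forall_mem_sphere_norm_le (c := z) (f := f) 2 hρ
    (hf.diffContOnCl_ball subset_rfl) (C := C * (1 + (‖z‖ + ρ))) fun w hw => by
      refine (hC w (sphere_subset_closedBall hw)).trans ?_
      have := norm_le_norm_add_norm_sub z w
      rw [mem_sphere, dist_comm, dist_eq_norm] at hw
      gcongr
      linarith
  simpa [iteratedDeriv_succ, Nat.factorial] using h

theorem isOpen_halfPlane (R : ℝ) : IsOpen {z : ℂ | R < z.re} :=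
  isOpen_lt continuous_const Complex.continuous_re

open Filter Topology Metric in
/-- Second order divided differences of a holomorphic function of linear growth on a half plane
tend to zero. -/
theorem tendsto_second_difference_of_linear_growth {R C : ℝ} {f : ℂ → ℂ} (hC0 : 0 ≤ C)
    (hf : DifferentiableOn ℂ f {z | R < z.re})
    (hC : ∀ z : ℂ, R < z.re → ‖f z‖ ≤ C * (1 + ‖z‖)) (p q r : ℕ) :
    Tendsto (fun k : ℕ => ((r : ℂ) - q) * f (k + p) - ((r : ℂ) - p) * f (k + q)
      + ((q : ℂ) - p) * f (k + r)) atTop (𝓝 0) := by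
  set W : ℝ := p + q + r with hW
  set M : ℝ := |(r : ℝ) - q| * p + |(r : ℝ) - p| * q + |(q : ℝ) - p| * r with hM
  refine squeeze_zero_norm' (a := fun k : ℕ => 96 * C * W * M / k) ?_
    (tendsto_const_nhds.div_atTop tendsto_natCast_atTop_atTop)
  -- k > 2R keeps the disc of radius k/2 about k in the half plane; k > 4W puts all three shifts
  -- within k/4 of k.
  filter_upwards [tendsto_natCast_atTop_atTop.eventually_gt_atTop (max 1 (max (2 * R) (4 * W)))]
    with k hk
  have hk1 : (1 : ℝ) < k := (le_max_left _ _).trans_lt hk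
  have hkR : 2 * R < (k : ℝ) := ((le_max_left _ _).trans (le_max_right _ _)).trans_lt hk
  have hkW : 4 * W < (k : ℝ) := ((le_max_right _ _).trans (le_max_right _ _)).trans_lt hk
  have hk0 : (0 : ℝ) < k := by linarith
  have hre {w : ℂ} (hw : ‖w - k‖ ≤ k / 2) : R < w.re := by
    have h1 := (abs_le.1 (Complex.abs_re_le_norm (w - k))).1
    simp only [Complex.sub_re, Complex.natCast_re] at h1
    linarith
  have hW0 : 0 ≤ W := by positivity
  have hball {w v : ℂ} (hw : w ∈ ball (k : ℂ) (k / 4)) (hv : v ∈ closedBall w (k / 4 : ℝ)) :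
      ‖v - k‖ ≤ k / 2 := by
    rw [mem_ball, dist_eq_norm] at hw
    rw [mem_closedBall, dist_eq_norm] at hv
    have := norm_add_le (v - w) (w - k)
    rw [sub_add_sub_cancel] at this
    linarith
  have hself {w : ℂ} (hw : w ∈ ball (k : ℂ) (k / 4)) : R < w.re :=
    hre (hball hw (mem_closedBall_self (by positivity)))
  -- Cauchy with ρ = k/4 and 1 + |w| + k/4 ≤ 3k: the constant is 2 · 3 · 16 = 96.
  have hdd : ∀ w ∈ ball (k : ℂ) (k / 4), ‖deriv (deriv f) w‖ ≤ 96 * C / k := fun w hw => by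
    refine (norm_deriv_deriv_le_of_linear_growth hC0 (by positivity : (0 : ℝ) < k / 4)
      (hf.mono fun v hv => hre (hball hw hv)) fun v hv => hC v (hre (hball hw hv))).trans ?_
    have h1 : 1 + (‖w‖ + k / 4) ≤ 3 * (k : ℝ) := by
      rw [mem_ball, dist_comm, dist_eq_norm] at hw
      have := norm_le_norm_add_norm_sub (k : ℂ) w
      rw [Complex.norm_natCast] at this
      linarith
    rw [div_le_div_iff₀ (by positivity) hk0]
    nlinarith [mul_le_mul_of_nonneg_left h1 (mul_nonneg hC0 hk0.le)]
  have hdf : DifferentiableOn ℂ (deriv f) {z | R < z.re} := hf.deriv (isOpen_halfPlane R)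
  have hat {g : ℂ → ℂ} (hg : DifferentiableOn ℂ g {z | R < z.re}) {w : ℂ}
      (hw : w ∈ ball (k : ℂ) (k / 4)) : DifferentiableAt ℂ g w :=
    hg.differentiableAt ((isOpen_halfPlane R).mem_nhds (hself hw))
  have hkk : (k : ℂ) ∈ ball (k : ℂ) (k / 4) := mem_ball_self (by positivity)
  have hsub : closedBall (k : ℂ) W ⊆ ball (k : ℂ) (k / 4) :=
    closedBall_subset_ball (by linarith)
  -- The weights r-q, -(r-p), q-p annihilate affine functions, so f may be replaced by h - h(k),
  -- whose derivative is small near k.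
  let h : ℂ → ℂ := fun w => f w - w * deriv f k
  have hh : ∀ w ∈ ball (k : ℂ) (k / 4), HasDerivAt h (deriv f w - deriv f k) w := fun w hw => by
    have := (hat hf hw).hasDerivAt.sub ((hasDerivAt_id w).mul_const (deriv f k))
    rwa [one_mul] at this
  have hkW' : (k : ℂ) ∈ closedBall (k : ℂ) W := mem_closedBall_self hW0
  have hh' : ∀ w ∈ closedBall (k : ℂ) W, ‖deriv h w‖ ≤ 96 * C / k * W := fun w hw => by
    rw [(hh w (hsub hw)).deriv]
    refine ((convex_ball _ _).norm_image_sub_le_of_norm_deriv_le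
      (fun v hv => hat hdf hv) hdd hkk (hsub hw)).trans ?_
    rw [mem_closedBall, dist_eq_norm] at hw
    gcongr
  have hstep : ∀ n : ℕ, (n : ℝ) ≤ W → ‖h (k + n) - h k‖ ≤ 96 * C / k * W * n := fun n hn => by
    refine ((convex_closedBall (k : ℂ) W).norm_image_sub_le_of_norm_deriv_le
      (fun v hv => (hh v (hsub hv)).differentiableAt) hh' hkW'
        (by simpa [mem_closedBall, dist_eq_norm] using hn)).trans ?_
    simp
  have hid : ((r : ℂ) - q) * f (k + p) - ((r : ℂ) - p) * f (k + q) + ((q : ℂ) - p) * f (k + r) =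
      ((r : ℂ) - q) * (h (k + p) - h k) - ((r : ℂ) - p) * (h (k + q) - h k)
        + ((q : ℂ) - p) * (h (k + r) - h k) := by
    simp only [h]
    ring
  have hint (a b : ℕ) : ‖(a : ℂ) - b‖ = |(a : ℝ) - b| := by
    rw [← Complex.ofReal_natCast, ← Complex.ofReal_natCast, ← Complex.ofReal_sub,
      Complex.norm_real, Real.norm_eq_abs]
  rw [hid]
  refine ((norm_add_le _ _).trans (add_le_add_left (norm_sub_le _ _) _)).trans ?_
  simp only [norm_mul, hint]
  have hp := hstep p (by simp only [hW]; linarith [(q.cast_nonneg : (0 : ℝ) ≤ q), (r.cast_nonneg : (0 : ℝ) ≤ r)])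
  have hq := hstep q (by simp only [hW]; linarith [(p.cast_nonneg : (0 : ℝ) ≤ p), (r.cast_nonneg : (0 : ℝ) ≤ r)])
  have hr := hstep r (by simp only [hW]; linarith [(q.cast_nonneg : (0 : ℝ) ≤ q), (p.cast_nonneg : (0 : ℝ) ≤ p)])
  calc _ ≤ |(r : ℝ) - q| * (96 * C / k * W * p) + |(r : ℝ) - p| * (96 * C / k * W * q)
        + |(q : ℝ) - p| * (96 * C / k * W * r) := by gcongr
    _ = 96 * C * W * M / k := by rw [hM]; ring

theorem exists_three_eq_of_fintype {ι : Type*} [Fintype ι] (c : ℕ → ι) (k : ℕ) :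
    ∃ p q r : ℕ, p < q ∧ q < r ∧ r < 2 * Fintype.card ι + 1 ∧
      c (k + p) = c (k + q) ∧ c (k + q) = c (k + r) := by
  classical
  obtain ⟨y, -, hy⟩ := Finset.exists_lt_card_fiber_of_mul_lt_card_of_maps_to
    (s := Finset.range (2 * Fintype.card ι + 1)) (t := (Finset.univ : Finset ι))
    (f := fun p => c (k + p)) (n := 2) (fun _ _ => Finset.mem_univ _)
    (by rw [Finset.card_range, Finset.card_univ]; omega)
  obtain ⟨a, ha, b, hb, d, hd, hab, had, hbd⟩ := Finset.two_lt_card.1 hy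
  simp only [Finset.mem_filter, Finset.mem_range] at ha hb hd
  obtain ⟨ha, ha'⟩ := ha
  obtain ⟨hb, hb'⟩ := hb
  obtain ⟨hd, hd'⟩ := hd
  rcases lt_or_gt_of_ne hab with h1 | h1 <;> rcases lt_or_gt_of_ne had with h2 | h2 <;>
    rcases lt_or_gt_of_ne hbd with h3 | h3
  · exact ⟨a, b, d, h1, h3, hd, by rw [ha', hb'], by rw [hb', hd']⟩
  · exact ⟨a, d, b, h2, h3, hb, by rw [ha', hd'], by rw [hd', hb']⟩
  · omega
  · exact ⟨d, a, b, h2, h1, hb, by rw [hd', ha'], by rw [ha', hb']⟩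
  · exact ⟨b, a, d, h1, h2, hd, by rw [hb', ha'], by rw [ha', hd']⟩
  · omega
  · exact ⟨b, d, a, h3, h2, ha, by rw [hb', hd'], by rw [hd', ha']⟩
  · exact ⟨d, b, a, h3, h1, ha, by rw [hd', hb'], by rw [hb', ha']⟩

open Filter Topology in
-- Every window of 2|S| + 1 consecutive integers has three points with the same l in S; there the
-- weights cancel the affine part and leave 2πi times an integer. Such values tending to 0 must
-- vanish, and a window offers only finitely many triples.
theorem exists_frequently_second_difference_eq_zero {R C : ℝ} {f : ℂ → ℂ} (hC0 : 0 ≤ C)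
    (hf : DifferentiableOn ℂ f {z | R < z.re})
    (hC : ∀ z : ℂ, R < z.re → ‖f z‖ ≤ C * (1 + ‖z‖)) (S : Finset (ℂ × ℂ))
    (hS : ∀ k : ℕ, R < k →
      ∃ l ∈ S, ∃ m : ℤ, f k = k * l.1 + l.2 + 2 * Real.pi * Complex.I * m) :
    ∃ p q r : ℕ, p < q ∧ q < r ∧ ∃ᶠ k : ℕ in atTop,
      ((r : ℂ) - q) * f (k + p) - ((r : ℂ) - p) * f (k + q) + ((q : ℂ) - p) * f (k + r) = 0 := by
  classical
  by_contra! hcon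
  set N := 2 * Fintype.card S + 1
  let D (t : ℕ × ℕ × ℕ) (k : ℕ) : ℂ := ((t.2.2 : ℂ) - t.2.1) * f (k + t.1)
    - ((t.2.2 : ℂ) - t.1) * f (k + t.2.1) + ((t.2.1 : ℂ) - t.1) * f (k + t.2.2)
  let T := Finset.range N ×ˢ Finset.range N ×ˢ Finset.range N
  have h1 : ∀ᶠ k in atTop, ∀ t ∈ T, ‖D t k‖ < 1 := by
    rw [Finset.eventually_all]
    intro t _
    have := (tendsto_second_difference_of_linear_growth hC0 hf hC t.1 t.2.1 t.2.2).norm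
    rw [norm_zero] at this
    exact this.eventually_lt_const one_pos
  have h2 : ∀ᶠ k in atTop, ∀ t ∈ T, t.1 < t.2.1 → t.2.1 < t.2.2 → D t k ≠ 0 := by
    rw [Finset.eventually_all]
    intro t _
    by_cases ht : t.1 < t.2.1 ∧ t.2.1 < t.2.2
    · exact (hcon t.1 t.2.1 t.2.2 ht.1 ht.2).mono fun k hk _ _ => hk
    · exact .of_forall fun k ha hb => absurd ⟨ha, hb⟩ ht
  obtain ⟨k₀, hk₀⟩ := exists_nat_gt R
  choose! l hl m hm using hS
  have hgt (j : ℕ) : R < (k₀ + j : ℕ) := by push_cast; linarith [(j.cast_nonneg : (0 : ℝ) ≤ j)]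
  let c : ℕ → S := fun j => ⟨l (k₀ + j), hl _ (hgt j)⟩
  obtain ⟨k, hk1, hk2, hk⟩ := (h1.and (h2.and (eventually_ge_atTop k₀))).exists
  obtain ⟨k, rfl⟩ := Nat.exists_eq_add_of_le hk
  obtain ⟨p, q, r, hpq, hqr, hr, e1, e2⟩ := exists_three_eq_of_fintype c k
  have hT : (p, q, r) ∈ T := by
    simp only [T, Finset.mem_product, Finset.mem_range]
    omega
  have hn1 := hk1 _ hT
  have hn2 := hk2 _ hT hpq hqr
  have e1' : l (k₀ + k + p) = l (k₀ + k + q) := by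
    simpa [c, add_assoc] using e1
  have e2' : l (k₀ + k + r) = l (k₀ + k + q) := by
    simpa [c, add_assoc] using e2.symm
  have hval (j : ℕ) := hm (k₀ + k + j) (by rw [add_assoc]; exact hgt _)
  have hD : D (p, q, r) (k₀ + k) = 2 * Real.pi * Complex.I *
      ((((r : ℤ) - q) * m (k₀ + k + p) - ((r : ℤ) - p) * m (k₀ + k + q)
        + ((q : ℤ) - p) * m (k₀ + k + r) : ℤ) : ℂ) := by
    have hp := hval p
    have hq := hval q
    have hr := hval r
    rw [e1'] at hp
    rw [e2'] at hr
    push_cast at hp hq hr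
    simp only [D]
    push_cast
    rw [hp, hq, hr]
    ring
  rw [hD] at hn1 hn2
  have hne := right_ne_zero_of_mul hn2
  have habs : (1 : ℝ) ≤ ‖((((r : ℤ) - q) * m (k₀ + k + p) - ((r : ℤ) - p) * m (k₀ + k + q)
        + ((q : ℤ) - p) * m (k₀ + k + r) : ℤ) : ℂ)‖ := by
    rw [Complex.norm_intCast]
    exact_mod_cast Int.one_le_abs (by exact_mod_cast hne)
  rw [norm_mul] at hn1
  have hpi : ‖(2 * Real.pi * Complex.I : ℂ)‖ = 2 * Real.pi := by
    simp [abs_of_pos Real.pi_pos]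
  rw [hpi] at hn1
  nlinarith [Real.pi_gt_three]

/-! ### From infinitely many zeros to a recurrence, and from it to f'' = 0 -/

open Polynomial Filter Topology in
/-- A holomorphic function on a half plane that is integral over the polynomials vanishes as soon
as it has infinitely many zeros among the natural numbers. -/
theorem Polynomial.Monic.eq_zero_of_frequently_eq_zero {M : ℂ[X][X]} (hM : M.Monic) {R : ℝ}
    {D : ℂ → ℂ} (hD : DifferentiableOn ℂ D {z | R < z.re})
    (h0 : ∀ z : ℂ, R < z.re → M.evalEval z (D z) = 0) (hfreq : ∃ᶠ k : ℕ in atTop, D k = 0)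
    {z : ℂ} (hz : R < z.re) : D z = 0 := by
  -- Write M = tⁿq with q(z,0) a nonzero polynomial. At a large zero k of D one has q(k,0) ≠ 0, so
  -- q(z, D z) ≠ 0 nearby, forcing D = 0 there; the identity theorem spreads this.
  obtain ⟨q, hq, hdvd⟩ := exists_eq_pow_rootMultiplicity_mul_and_not_dvd M hM.ne_zero 0
  set n := rootMultiplicity 0 M
  have hs : q.eval 0 ≠ 0 := fun h => hdvd (dvd_iff_isRoot.2 h)
  have hev : ∀ᶠ k : ℕ in atTop, (q.eval 0).eval (k : ℂ) ≠ 0 := by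
    have hfin : {k : ℕ | (q.eval 0).eval (k : ℂ) = 0}.Finite :=
      ((q.eval 0).roots.toFinset.finite_toSet.preimage Nat.cast_injective.injOn).subset
        fun k hk => by simpa [hs] using hk
    have := hfin.compl_mem_cofinite
    rwa [Nat.cofinite_eq_atTop] at this
  obtain ⟨k, hk0, hk1, hkR⟩ := (hfreq.and_eventually (hev.and
    (tendsto_natCast_atTop_atTop.eventually_gt_atTop R))).exists
  have hH := isOpen_halfPlane R
  have hkH : (k : ℂ) ∈ {z : ℂ | R < z.re} := by simpa using hkR
  have hcont : ContinuousAt (fun z => q.evalEval z (D z)) k :=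
    ((q.contDiff_evalEval 0).continuous.continuousAt).comp (f := fun z => (z, D z))
      (continuousAt_id.prodMk (hD.continuousOn.continuousAt (hH.mem_nhds hkH)))
  have hne : q.evalEval (k : ℂ) (D k) ≠ 0 := by
    simpa [evalEval, hk0] using hk1
  have hloc : D =ᶠ[𝓝 (k : ℂ)] 0 := by
    filter_upwards [hcont.eventually_ne hne, hH.mem_nhds hkH] with w hw hwH
    have := h0 w hwH
    rw [hq, evalEval_mul, mul_eq_zero] at this
    have := this.resolve_right hw
    simp only [evalEval_pow, evalEval_X, map_zero, sub_zero] at this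
    exact eq_zero_of_pow_eq_zero this
  exact (hD.analyticOnNhd hH).eqOn_zero_of_preconnected_of_eventuallyEq_zero
    (convex_halfSpace_re_gt R).isPreconnected hkH hloc hz

open Polynomial in
theorem Polynomial.eval₂_piRingHom_evalRingHom {S : Type*} (ζ : S → ℂ) (g : S → ℂ) (M : ℂ[X][X])
    (s : S) : (M.eval₂ (RingHom.pi fun s => evalRingHom (ζ s)) g) s = M.evalEval (ζ s) (g s) := by
  have := Polynomial.hom_eval₂ M (RingHom.pi fun s => evalRingHom (ζ s))
    (Pi.evalRingHom (fun _ : S => ℂ) s) g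
  rw [← map_evalRingHom_eval, eval_map]
  exact this

open Polynomial Filter in
-- In the ring of functions on the half plane, each shift of f is integral over ℂ[z], being a root
-- of Q with shifted coefficients. Hence so is the second difference, and its infinitely many zeros
-- force it to vanish.
theorem Polynomial.Monic.second_difference_eq_zero {Q : ℂ[X][X]} (hQ : Q.Monic) {R : ℝ}
    {f : ℂ → ℂ} (hf : DifferentiableOn ℂ f {z | R < z.re})
    (h0 : ∀ z : ℂ, R < z.re → Q.evalEval z (f z) = 0) {p q r : ℕ}
    (hfreq : ∃ᶠ k : ℕ in atTop, ((r : ℂ) - q) * f (k + p) - ((r : ℂ) - p) * f (k + q)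
      + ((q : ℂ) - p) * f (k + r) = 0) {z : ℂ} (hz : R < z.re) :
    ((r : ℂ) - q) * f (z + p) - ((r : ℂ) - p) * f (z + q) + ((q : ℂ) - p) * f (z + r) = 0 := by
  let S := {z : ℂ // R < z.re}
  let φ : ℂ[X] →+* (S → ℂ) := RingHom.pi fun s => evalRingHom (s : ℂ)
  have hshift {n : ℕ} {w : ℂ} (hw : R < w.re) : R < (w + n).re := by
    simp only [Complex.add_re, Complex.natCast_re]
    linarith [(n.cast_nonneg : (0 : ℝ) ≤ n)]
  have hint (n : ℕ) : φ.IsIntegralElem (fun s : S => f (s + n)) := by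
    refine ⟨Q.map (compRingHom (X + Polynomial.C (n : ℂ))), hQ.map _, ?_⟩
    funext s
    rw [eval₂_piRingHom_evalRingHom, ← map_evalRingHom_eval, Polynomial.map_map]
    have : (evalRingHom (s : ℂ)).comp (compRingHom (X + Polynomial.C (n : ℂ))) =
        evalRingHom ((s : ℂ) + n) := by
      ext <;> simp
    rw [this, map_evalRingHom_eval]
    exact h0 _ (hshift s.2)
  have hconst (c : ℂ) : φ.IsIntegralElem (fun _ : S => c) := by
    convert φ.isIntegralElem_map (x := Polynomial.C c) using 1
    ext s
    simp [φ, RingHom.pi]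
  obtain ⟨M, hM, hM0⟩ := RingHom.IsIntegralElem.add φ (RingHom.IsIntegralElem.sub φ
    ((hconst ((r : ℂ) - q)).mul φ (hint p)) ((hconst ((r : ℂ) - p)).mul φ (hint q)))
    ((hconst ((q : ℂ) - p)).mul φ (hint r))
  refine hM.eq_zero_of_frequently_eq_zero (R := R) (D := fun z => ((r : ℂ) - q) * f (z + p)
    - ((r : ℂ) - p) * f (z + q) + ((q : ℂ) - p) * f (z + r)) ?_ (fun w hw => ?_) hfreq hz
  · have hd (n : ℕ) : DifferentiableOn ℂ (fun z => f (z + n)) {z | R < z.re} :=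
      hf.comp (by fun_prop) fun w hw => hshift hw
    exact (((hd p).const_mul _).sub ((hd q).const_mul _)).add ((hd r).const_mul _)
  · have := congrFun hM0 ⟨w, hw⟩
    rwa [eval₂_piRingHom_evalRingHom] at this

open Polynomial Filter Topology Metric in
/-- A root of linear growth satisfying a forward recurrence on a half plane extends holomorphically
to all half planes, hence has vanishing second derivative. -/
theorem Polynomial.deriv_deriv_eq_zero_of_recurrence {Q : ℂ[X][X]} {R C : ℝ} (hC0 : 0 ≤ C)
    (hC : ∀ z t, Q.evalEval z t = 0 → ‖t‖ ≤ C * (1 + ‖z‖)) {f : ℂ → ℂ}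
    (hf : DifferentiableOn ℂ f {z | R < z.re})
    (h0 : ∀ z : ℂ, R < z.re → Q.evalEval z (f z) = 0) {a b : ℕ} (ha : 1 ≤ a) (hb : 1 ≤ b)
    {c d : ℂ} (hrec : ∀ z : ℂ, R < z.re → f z = c * f (z + a) + d * f (z + b)) {z : ℂ}
    (hz : R < z.re) : deriv (deriv f) z = 0 := by
  -- `F j` iterates the right-hand side of the recurrence j times; since a, b ≥ 1, each iteration
  -- gains a strip of width 1 on the left.
  obtain ⟨F, hF0, hF⟩ : ∃ F : ℕ → ℂ → ℂ, F 0 = f ∧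
      ∀ j, F (j + 1) = fun z => c * F j (z + a) + d * F j (z + b) :=
    ⟨fun j => Nat.rec f (fun _ g z => c * g (z + a) + d * g (z + b)) j, rfl, fun _ => rfl⟩
  have hshift {n : ℕ} (hn : 1 ≤ n) {j : ℕ} {w : ℂ} (hw : R - (j + 1 : ℕ) < w.re) :
      R - j < (w + n).re := by
    have : (1 : ℝ) ≤ n := by exact_mod_cast hn
    push_cast at hw
    simp only [Complex.add_re, Complex.natCast_re]
    linarith
  have hd (j : ℕ) : DifferentiableOn ℂ (F j) {z | R - j < z.re} := by
    induction j with
    | zero => simpa [hF0] using hf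
    | succ j ih =>
      have hcomp {n : ℕ} (hn : 1 ≤ n) :
          DifferentiableOn ℂ (fun z => F j (z + n)) {z | R - (j + 1 : ℕ) < z.re} :=
        ih.comp (by fun_prop) fun w hw => hshift hn hw
      rw [hF]
      exact ((hcomp ha).const_mul c).add ((hcomp hb).const_mul d)
  have hstep (j : ℕ) : ∀ z : ℂ, R - j < z.re → F (j + 1) z = F j z := by
    induction j with
    | zero => exact fun z hz => by rw [hF, hF0]; exact (hrec z (by simpa using hz)).symm
    | succ j ih =>
      intro z hz
      rw [hF (j + 1)]
      simp only [ih _ (hshift ha hz), ih _ (hshift hb hz)]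
      rw [hF j]
  have heq (j : ℕ) : ∀ z : ℂ, R < z.re → F j z = f z := by
    induction j with
    | zero => exact fun _ _ => by rw [hF0]
    | succ j ih =>
      intro z hz
      rw [hstep j z (by linarith [(j.cast_nonneg : (0 : ℝ) ≤ j)]), ih z hz]
  have heq' (j : ℕ) {w : ℂ} (hw : R < w.re) : F j =ᶠ[𝓝 w] f :=
    eventually_of_mem ((isOpen_halfPlane R).mem_nhds hw) (heq j)
  -- By the identity theorem the continuation is still a root of Q, so it obeys the growth bound
  -- with the same C.
  have hroot (j : ℕ) : ∀ w : ℂ, R - j < w.re → Q.evalEval w (F j w) = 0 := by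
    have hdiff : DifferentiableOn ℂ (fun w => Q.evalEval w (F j w)) {z | R - j < z.re} :=
      ((Q.contDiff_evalEval 1).differentiable one_ne_zero).comp_differentiableOn
        (differentiableOn_id.prodMk (hd j))
    intro w hw
    refine (hdiff.analyticOnNhd (isOpen_halfPlane _)).eqOn_zero_of_preconnected_of_eventuallyEq_zero
      (convex_halfSpace_re_gt _).isPreconnected (z₀ := z) ?_ ?_ hw
    · change R - j < z.re
      linarith [(j.cast_nonneg : (0 : ℝ) ≤ j)]
    · filter_upwards [heq' j hz, (isOpen_halfPlane R).mem_nhds hz] with v hv hvR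
      simpa [hv] using h0 v hvR
  -- The disc of radius j about z lies in the domain of `F j`, and Cauchy's estimate there is
  -- O(1/j).
  have hbound : ∀ᶠ j : ℕ in atTop, ‖deriv (deriv f) z‖ ≤ 2 * C * (2 + ‖z‖) / j := by
    filter_upwards [eventually_ge_atTop 1] with j hj
    have hj1 : (1 : ℝ) ≤ j := by exact_mod_cast hj
    have hsub {w : ℂ} (hw : w ∈ closedBall z j) : R - j < w.re := by
      rw [mem_closedBall, dist_eq_norm] at hw
      have h1 := (abs_le.1 (Complex.abs_re_le_norm (w - z))).1
      simp only [Complex.sub_re] at h1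
      linarith
    have h := norm_deriv_deriv_le_of_linear_growth hC0 (by linarith : (0 : ℝ) < j)
      ((hd j).mono fun w hw => hsub hw) fun w hw => hC _ _ (hroot j w (hsub hw))
    rw [(heq' j hz).deriv.deriv_eq] at h
    refine h.trans ?_
    rw [div_le_div_iff₀ (by positivity) (by positivity)]
    have h2 : 1 + (‖z‖ + j) ≤ (2 + ‖z‖) * j := by nlinarith [norm_nonneg z]
    calc 2 * (C * (1 + (‖z‖ + j))) * j ≤ 2 * (C * ((2 + ‖z‖) * j)) * j := by gcongr
      _ = 2 * C * (2 + ‖z‖) * j ^ 2 := by ring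
  have := ge_of_tendsto (tendsto_const_nhds.div_atTop tendsto_natCast_atTop_atTop) hbound
  simpa using this

theorem exists_affine_of_deriv_deriv_eq_zero {R : ℝ} {f : ℂ → ℂ}
    (hf : DifferentiableOn ℂ f {z | R < z.re})
    (h : ∀ z : ℂ, R < z.re → deriv (deriv f) z = 0) :
    ∃ a b : ℂ, ∀ z : ℂ, R < z.re → f z = a * z + b := by
  have hH := isOpen_halfPlane R
  have hpre : IsPreconnected {z : ℂ | R < z.re} := (convex_halfSpace_re_gt R).isPreconnected
  obtain ⟨x, hx⟩ := exists_gt R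
  have hx' : (x : ℂ) ∈ {z : ℂ | R < z.re} := by simpa using hx
  have h1 {z : ℂ} (hz : R < z.re) : deriv f z = deriv f x :=
    hH.is_const_of_deriv_eq_zero hpre (hf.deriv hH) (fun w hw => h w hw) hz hx'
  have hg {z : ℂ} (hz : R < z.re) :
      HasDerivAt (fun z => f z - deriv f x * z) 0 z := by
    have := (hf.differentiableAt (hH.mem_nhds hz)).hasDerivAt.sub
      ((hasDerivAt_id z).const_mul (deriv f x))
    rwa [h1 hz, mul_one, sub_self] at this
  refine ⟨deriv f x, f x - deriv f x * x, fun z hz => ?_⟩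
  have := hH.is_const_of_deriv_eq_zero hpre
    (fun w hw => (hg hw).differentiableAt.differentiableWithinAt) (fun w hw => (hg hw).deriv) hz hx'
  linear_combination this

/-! ### Splitting off affine factors -/

open Polynomial Filter Topology Metric in
theorem Polynomial.Monic.exists_affine_dvd {P : ℂ[X][X]} (hP : P.Monic) (hd : P.natDegree ≠ 0)
    {C : ℝ} (hC0 : 0 ≤ C) (hC : ∀ z t, P.evalEval z t = 0 → ‖t‖ ≤ C * (1 + ‖z‖))
    (S : Finset (ℂ × ℂ)) (hS : ∀ (k : ℕ) (t : ℂ), P.evalEval (k : ℂ) t = 0 →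
      ∃ l ∈ S, ∃ m : ℤ, t = k * l.1 + l.2 + 2 * Real.pi * Complex.I * m) :
    ∃ a b : ℂ, X - Polynomial.C (Polynomial.C a * X + Polynomial.C b) ∣ P := by
  obtain ⟨Q, hQ, hQP, hQd, r, u, v, hr0, hr⟩ := hP.exists_dvd_resultant_derivative_ne_zero hd
  have hroot {z t : ℂ} (h : Q.evalEval z t = 0) : P.evalEval z t = 0 := by
    obtain ⟨Q', rfl⟩ := hQP
    rw [evalEval_mul, h, zero_mul]
  obtain ⟨R, hR⟩ : ∃ R : ℝ, ∀ z : ℂ, R < z.re → r.eval z ≠ 0 := by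
    obtain ⟨R, hR⟩ := (r.roots.toFinset.finite_toSet.image Complex.re).bddAbove
    exact ⟨R, fun z hz h => hz.not_ge (hR ⟨z, by simpa [hr0] using h, rfl⟩)⟩
  have hsc : IsSimplyConnected {z : ℂ | R < z.re} := by
    have : ContractibleSpace {z : ℂ | R < z.re} :=
      (convex_halfSpace_re_gt R).contractibleSpace ⟨((R + 1 : ℝ) : ℂ), by simp⟩
    exact SimplyConnectedSpace.ofContractible _
  obtain ⟨f, hf, hf0⟩ := hQ.exists_differentiableOn_root hQd (fun z t h => hC z t (hroot h)) hr
    (isOpen_halfPlane R) hsc hR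
  obtain ⟨p, q, s, hpq, hqs, hfreq⟩ := exists_frequently_second_difference_eq_zero hC0 hf
    (fun z hz => hC _ _ (hroot (hf0 z hz))) S fun k hk => hS k _ (hroot (hf0 (k : ℂ) (by simpa using hk)))
  have hD := fun z hz => hQ.second_difference_eq_zero hf hf0 hfreq (z := z) hz
  obtain ⟨a, rfl⟩ := Nat.exists_eq_add_of_le hpq.le
  obtain ⟨b, rfl⟩ := Nat.exists_eq_add_of_le (hpq.trans hqs).le
  have hab : a < b := by omega
  have hba : (b : ℂ) - a ≠ 0 := sub_ne_zero.2 (by exact_mod_cast hab.ne')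
  have hsub : {z : ℂ | R + p < z.re} ⊆ {z | R < z.re} := fun z hz => by
    have : R + p < z.re := hz
    change R < z.re
    linarith [(p.cast_nonneg : (0 : ℝ) ≤ p)]
  -- With q = p + a and s = p + b, the relation at z - p reads (b-a) f(z) - b f(z+a) + a f(z+b) = 0;
  -- the shift by p costs the strip up to R + p.
  have hrec : ∀ z : ℂ, R + p < z.re → f z = b / (b - a) * f (z + a) + -a / (b - a) * f (z + b) := by
    intro z hz
    have h := hD (z - p) (by simp only [Complex.sub_re, Complex.natCast_re]; linarith)
    have e (n : ℕ) : z - p + (p + n : ℕ) = z + n := by push_cast; ring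
    rw [e, e, sub_add_cancel] at h
    push_cast at h
    field_simp
    linear_combination h
  have hff := hf.mono hsub
  obtain ⟨c, d, hcd⟩ := exists_affine_of_deriv_deriv_eq_zero hff fun z hz =>
    deriv_deriv_eq_zero_of_recurrence hC0 (fun z t h => hC z t (hroot h)) hff
      (fun z hz => hf0 z (hsub hz)) (by omega) (by omega) hrec hz
  refine ⟨c, d, (dvd_iff_isRoot.2 ?_).trans hQP⟩
  obtain ⟨k, hk⟩ := exists_nat_gt (R + p)
  -- Q(z, cz + d) is a polynomial in z that vanishes at all large integers.
  refine eq_zero_of_infinite_isRoot _ (Set.infinite_of_injective_forall_mem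
    (f := fun n : ℕ => ((k + n : ℕ) : ℂ)) (fun m n h => by simpa using h) fun n => ?_)
  have hn : R + p < ((k + n : ℕ) : ℂ).re := by
    rw [Complex.natCast_re]
    push_cast
    linarith [(n.cast_nonneg : (0 : ℝ) ≤ n)]
  have h := hf0 _ (hsub hn)
  rw [hcd _ hn, ← map_evalRingHom_eval, eval_map] at h
  change evalRingHom _ (eval _ Q) = 0
  rw [← eval₂_hom]
  simpa using h

open Polynomial in
/-- A monic bivariate polynomial with roots of linear growth whose roots above each natural number
`k` lie, modulo `2πi`, on finitely many given affine functions of `k`, splits into affine factors. -/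
theorem Polynomial.Monic.eq_prod_affine (n : ℕ) {P : ℂ[X][X]} (hP : P.Monic)
    (hd : P.natDegree = n)
    {C : ℝ} (hC0 : 0 ≤ C) (hC : ∀ z t, P.evalEval z t = 0 → ‖t‖ ≤ C * (1 + ‖z‖))
    (S : Finset (ℂ × ℂ)) (hS : ∀ (k : ℕ) (t : ℂ), P.evalEval (k : ℂ) t = 0 →
      ∃ l ∈ S, ∃ m : ℤ, t = k * l.1 + l.2 + 2 * Real.pi * Complex.I * m) :
    ∃ a b : Fin n → ℂ,
      P = ∏ i, (X - Polynomial.C (Polynomial.C (a i) * X + Polynomial.C (b i))) := by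
  induction n generalizing P with
  | zero => exact ⟨0, 0, by simpa using hP.natDegree_eq_zero.1 hd⟩
  | succ n ih =>
    obtain ⟨a, b, P', rfl⟩ := hP.exists_affine_dvd (by omega) hC0 hC S hS
    have hX := monic_X_sub_C (Polynomial.C a * X + Polynomial.C b)
    have hP' : P'.Monic := hX.of_mul_monic_left hP
    have hroot {z t : ℂ} (h : P'.evalEval z t = 0) :
        ((X - Polynomial.C (Polynomial.C a * X + Polynomial.C b)) * P').evalEval z t = 0 := by
      rw [evalEval_mul, h, mul_zero]
    rw [hX.natDegree_mul hP', natDegree_X_sub_C] at hd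
    obtain ⟨a', b', h⟩ := ih hP' (by omega) (fun z t h => hC z t (hroot h))
      fun k t h => hS k t (hroot h)
    refine ⟨Fin.cons a a', Fin.cons b b', ?_⟩
    rw [Fin.prod_univ_succ]
    simp only [Fin.cons_zero, Fin.cons_succ, ← h]

/-! ### Eigenvalues and matrix exponentials -/

theorem Commute.exists_common_eigenvector {ι : Type*} [Fintype ι] [DecidableEq ι]
    {M N : Matrix ι ι ℂ} (h : Commute M N) {u : ℂ} {v : ι → ℂ} (hv : v ≠ 0)
    (hM : M.mulVec v = u • v) :
    ∃ w : ι → ℂ, w ≠ 0 ∧ M.mulVec w = u • w ∧ ∃ l : ℂ, N.mulVec w = l • w := by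
  let E := Module.End.eigenspace (Matrix.toLin' M) u
  have hE : ∀ w ∈ E, Matrix.toLin' N w ∈ E := fun w hw => by
    rw [Module.End.mem_eigenspace_iff, Matrix.toLin'_apply] at hw ⊢
    rw [Matrix.toLin'_apply, Matrix.mulVec_mulVec, h.eq, ← Matrix.mulVec_mulVec, hw,
      Matrix.mulVec_smul]
  have : Nontrivial E := ⟨⟨v, by simpa [E, Module.End.mem_eigenspace_iff] using hM⟩, 0,
    fun h => hv (congrArg Subtype.val h)⟩
  obtain ⟨l, hl⟩ := Module.End.exists_eigenvalue ((Matrix.toLin' N).restrict hE)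
  obtain ⟨w, hw⟩ := hl.exists_hasEigenvector
  refine ⟨w, fun h => hw.2 (Subtype.ext h), ?_, l, ?_⟩
  · exact Module.End.mem_eigenspace_iff.1 w.2
  · simpa using congrArg Subtype.val hw.apply_eq_smul

attribute [local instance] Matrix.linftyOpNormedRing Matrix.linftyOpNormedAlgebra
  Matrix.linftyOpNormedAddCommGroup Matrix.linftyOpNormedSpace in
theorem Matrix.exp_mulVec_of_mulVec_eq_smul {ι : Type*} [Fintype ι] [DecidableEq ι]
    {M : Matrix ι ι ℂ} {l : ℂ} {v : ι → ℂ} (h : M.mulVec v = l • v) :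
    (NormedSpace.exp M).mulVec v = Complex.exp l • v := by
  have hpow (n : ℕ) : (M ^ n).mulVec v = l ^ n • v := by
    induction n with
    | zero => simp
    | succ n ih => rw [pow_succ, ← Matrix.mulVec_mulVec, h, Matrix.mulVec_smul, ih, smul_smul,
        pow_succ']
  have h1 := (NormedSpace.exp_series_hasSum_exp' (𝕂 := ℂ) M).map
    (((Matrix.mulVecBilin ℂ ℂ).flip v : Matrix ι ι ℂ →ₗ[ℂ] (ι → ℂ)))
    (LinearMap.continuous_of_finiteDimensional _)
  have h2 := (NormedSpace.exp_series_hasSum_exp' (𝕂 := ℂ) l).smul_const v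
  rw [Complex.exp_eq_exp_ℂ]
  refine h1.unique ?_
  convert h2 using 1
  ext n
  simp [hpow, mul_assoc]

theorem Matrix.charpoly_isRoot_iff_exists_mulVec {ι : Type*} [Fintype ι] [DecidableEq ι]
    {M : Matrix ι ι ℂ} {t : ℂ} :
    M.charpoly.IsRoot t ↔ ∃ v : ι → ℂ, v ≠ 0 ∧ M.mulVec v = t • v := by
  rw [Polynomial.IsRoot.def, Matrix.eval_charpoly, ← Matrix.exists_mulVec_eq_zero_iff]
  simp only [Matrix.sub_mulVec, sub_eq_zero, Matrix.scalar_apply, ← Matrix.smul_one_eq_diagonal,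
    Matrix.smul_mulVec, Matrix.one_mulVec, eq_comm]

attribute [local instance] Matrix.linftyOpNormedRing Matrix.linftyOpNormedAlgebra in
theorem Matrix.exists_norm_le_of_isRoot_charpoly {ι : Type*} [Fintype ι] [DecidableEq ι]
    (A B : Matrix ι ι ℂ) : ∃ C : ℝ, 0 ≤ C ∧ ∀ z t : ℂ, (z • A + B).charpoly.IsRoot t →
      ‖t‖ ≤ C * (1 + ‖z‖) := by
  refine ⟨‖A‖ + ‖B‖, by positivity, fun z t h => ?_⟩
  obtain ⟨v, hv, h⟩ := Matrix.charpoly_isRoot_iff_exists_mulVec.1 h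
  have h1 := Matrix.linfty_opNorm_mulVec (z • A + B) v
  rw [h, norm_smul] at h1
  have h2 := (le_of_mul_le_mul_right h1 (norm_pos_iff.2 hv)).trans (norm_add_le _ _)
  rw [norm_smul] at h2
  nlinarith [norm_nonneg A, norm_nonneg B, norm_nonneg z, mul_nonneg (norm_nonneg z) (norm_nonneg B)]

attribute [local instance] Matrix.linftyOpNormedRing Matrix.linftyOpNormedAlgebra in
-- The commuting matrices exp(kA)exp(B) and exp(B) share an eigenvector w with eigenvalues exp(t)
-- and u, so exp(kA) has eigenvalue exp(t)/u on w. As exp(B) commutes with B and exp(kA) with A, u =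
-- exp(m) and exp(t)/u = exp(kl) for eigenvalues m, l. The eigenvectors of A and B may differ.
theorem Matrix.exists_eigenvalues_of_exp_smul_add {ι : Type*} [Fintype ι] [DecidableEq ι]
    {A B : Matrix ι ι ℂ} {k : ℂ}
    (h1 : NormedSpace.exp (k • A + B) = NormedSpace.exp (k • A) * NormedSpace.exp B)
    (h2 : NormedSpace.exp (k • A) * NormedSpace.exp B =
      NormedSpace.exp B * NormedSpace.exp (k • A)) {t : ℂ} (ht : (k • A + B).charpoly.IsRoot t) :
    ∃ l m : ℂ, A.charpoly.IsRoot l ∧ B.charpoly.IsRoot m ∧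
      ∃ j : ℤ, t = k * l + m + 2 * Real.pi * Complex.I * j := by
  simp only [Matrix.charpoly_isRoot_iff_exists_mulVec] at ht ⊢
  obtain ⟨v, hv, hvt⟩ := ht
  have hv' := Matrix.exp_mulVec_of_mulVec_eq_smul hvt
  have hcomm : Commute (NormedSpace.exp (k • A)) (NormedSpace.exp B) := h2
  rw [h1] at hv'
  obtain ⟨w, hw, hwt, u, hu⟩ := Commute.exists_common_eigenvector
    (hcomm.mul_left (Commute.refl (NormedSpace.exp B)) :
      Commute (NormedSpace.exp (k • A) * NormedSpace.exp B) (NormedSpace.exp B)) hv hv'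
  have hBB : Commute (NormedSpace.exp B) B := (Commute.refl B).exp_left
  have hAA : Commute (NormedSpace.exp (k • A)) A := ((Commute.refl A).smul_left k).exp_left
  obtain ⟨b, hb, hbu, m, hbm⟩ := hBB.exists_common_eigenvector hw hu
  have hum : u = Complex.exp m := smul_left_injective ℂ hb
    (hbu.symm.trans (Matrix.exp_mulVec_of_mulVec_eq_smul hbm))
  have hA : (NormedSpace.exp (k • A)).mulVec w = (Complex.exp t / u) • w := by
    rw [← Matrix.mulVec_mulVec, hu, Matrix.mulVec_smul] at hwt
    have hu0 : u ≠ 0 := hum ▸ Complex.exp_ne_zero m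
    rw [div_eq_inv_mul, mul_smul, ← hwt, smul_smul, inv_mul_cancel₀ hu0, one_smul]
  obtain ⟨a, ha, hau, l, hal⟩ := hAA.exists_common_eigenvector hw hA
  have hkl : (k • A).mulVec a = (k * l) • a := by rw [Matrix.smul_mulVec, hal, smul_smul]
  have hul : Complex.exp t / u = Complex.exp (k * l) := smul_left_injective ℂ ha
    (hau.symm.trans (Matrix.exp_mulVec_of_mulVec_eq_smul hkl))
  rw [div_eq_iff (hum ▸ Complex.exp_ne_zero m), hum, ← Complex.exp_add,
    Complex.exp_eq_exp_iff_exists_int] at hul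
  obtain ⟨j, hj⟩ := hul
  exact ⟨l, m, ⟨a, ha, hal⟩, ⟨b, hb, hbm⟩, j, by rw [hj]; ring⟩

/-! ### The characteristic polynomial of the pencil -/

open Polynomial in
theorem Matrix.map_charpoly_pencil {ι : Type*} [Fintype ι] [DecidableEq ι]
    (A B : Matrix ι ι ℂ) (z : ℂ) :
    (Matrix.charpoly ((X : ℂ[X]) • A.map Polynomial.C + B.map Polynomial.C)).map (evalRingHom z) =
      (z • A + B).charpoly := by
  rw [← Matrix.charpoly_map]
  congr 1
  ext i j
  simpa using mul_comm (A i j) z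

theorem Matrix.eval_charpoly_smul {n : ℕ} (M : Matrix (Fin n) (Fin n) ℂ) {y : ℂ} (hy : y ≠ 0)
    (t : ℂ) : (y • M).charpoly.eval t = y ^ n * M.charpoly.eval (t / y) := by
  rw [Matrix.eval_charpoly, Matrix.eval_charpoly]
  have : Matrix.scalar (Fin n) t - y • M = y • (Matrix.scalar (Fin n) (t / y) - M) := by
    rw [smul_sub, Matrix.scalar_apply, Matrix.scalar_apply, ← Matrix.smul_one_eq_diagonal,
      ← Matrix.smul_one_eq_diagonal, smul_smul, mul_div_cancel₀ _ hy]
  rw [this, Matrix.det_smul, Fintype.card_fin]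

open Polynomial in
-- Homogeneity reduces y ≠ 0 to the pencil zA + B with z = x/y; y = 0 follows by continuity in y.
theorem hasPropertyL_of_charpoly_eq_prod {n : ℕ} {A B : Matrix (Fin n) (Fin n) ℂ}
    {a b : Fin n → ℂ}
    (h : ∀ z : ℂ, (z • A + B).charpoly = ∏ i, (X - Polynomial.C (z * a i + b i))) :
    HasPropertyL A B := by
  have key : ∀ x y : ℂ, (x • A + y • B).charpoly =
      ∏ i, (X - Polynomial.C (x * a i + y * b i)) := by
    intro x y
    refine Polynomial.funext fun t => ?_
    have hc1 : Continuous fun y : ℂ => (x • A + y • B).charpoly.eval t := by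
      simp only [Matrix.eval_charpoly]
      fun_prop
    have hc2 : Continuous fun y : ℂ => (∏ i, (X - Polynomial.C (x * a i + y * b i))).eval t := by
      simp only [eval_prod, eval_sub, eval_X, eval_C]
      fun_prop
    refine congrFun (hc1.ext_on (dense_compl_singleton (0 : ℂ)) hc2 fun y hy => ?_) y
    have hy : y ≠ 0 := hy
    have : x • A + y • B = y • ((x / y) • A + B) := by
      rw [smul_add, smul_smul, mul_div_cancel₀ _ hy]
    simp only [this, Matrix.eval_charpoly_smul _ hy, h, eval_prod, eval_sub, eval_X, eval_C]
    rw [← Fin.prod_const, ← Finset.prod_mul_distrib]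
    refine Finset.prod_congr rfl fun i _ => ?_
    field_simp
  exact ⟨a, b, by simpa using key 1 0, by simpa using key 0 1, key⟩

theorem proposition3 (n : ℕ) (A B : Matrix (Fin n) (Fin n) ℂ)
    (h : ∀ k : ℕ,
      NormedSpace.exp ((k : ℂ) • A + B) =
        NormedSpace.exp ((k : ℂ) • A) * NormedSpace.exp B ∧
      NormedSpace.exp ((k : ℂ) • A) * NormedSpace.exp B =
        NormedSpace.exp B * NormedSpace.exp ((k : ℂ) • A)) :
    HasPropertyL A B := by
  classical
  let P := Matrix.charpoly ((Polynomial.X : Polynomial ℂ) • A.map Polynomial.C + B.map Polynomial.C)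
  have hP : P.Monic := Matrix.charpoly_monic _
  have hroot {z t : ℂ} (ht : P.evalEval z t = 0) : (z • A + B).charpoly.IsRoot t := by
    rwa [← Matrix.map_charpoly_pencil, Polynomial.IsRoot.def,
      Polynomial.map_evalRingHom_eval]
  obtain ⟨C, hC0, hC⟩ := Matrix.exists_norm_le_of_isRoot_charpoly A B
  obtain ⟨a, b, hab⟩ := hP.eq_prod_affine n (by simp [P]) hC0
    (fun z t ht => hC z t (hroot ht)) (A.charpoly.roots.toFinset ×ˢ B.charpoly.roots.toFinset)
    fun k t ht => by
      obtain ⟨l, m, hl, hm, j, hj⟩ :=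
        Matrix.exists_eigenvalues_of_exp_smul_add (h k).1 (h k).2 (hroot ht)
      refine ⟨(l, m), ?_, j, hj⟩
      simpa [A.charpoly_monic.ne_zero, B.charpoly_monic.ne_zero] using And.intro hl hm
  refine hasPropertyL_of_charpoly_eq_prod (a := a) (b := b) fun z => ?_
  rw [← Matrix.map_charpoly_pencil]
  change P.map _ = _
  rw [hab, Polynomial.map_prod]
  refine Finset.prod_congr rfl fun i _ => ?_
  rw [Polynomial.map_sub, Polynomial.map_X, Polynomial.map_C, Polynomial.coe_evalRingHom]
  simp only [Polynomial.eval_add, Polynomial.eval_mul, Polynomial.eval_C, Polynomial.eval_X,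
    mul_comm]
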